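/- **Conventions.** A *quantale* $Q$ is a complete lattice with a monoid structure $(Q,\cdot,1)$ whose product distributes over arbitrary joins in both arguments; an isomorphism of quantales is a bijective monoid homomorphism that preserves and reflects the order (equivalently, a bijective monoid homomorphism preserving arbitrary joins). A *left $Q$-module* is a complete lattice $M$ with an action of the monoid $Q$ that distributes over arbitrary joins in both arguments; homomorphisms preserve arbitrary joins and the action. Right modules and bimodules are defined analogously. Let ${}_Q\mathcal M$ and $\mathcal M_Q$ be the categories of left and right $Q$-modules. $Q$ and $R$ are *Morita equivalent* if the categories ${}_Q\mathcal M$ and ${}_R\mathcal M$ are equivalent. A left $Q$-module $P$ is *projective* if every homomorphism from $P$ to a left $Q$-module $B$ lifts through every surjective homomorphism $A\to B$; it is a *generator* if the left $Q$-module $Q$ is a retract of a power $P^I$ for some set $I$; it is a *progenerator* if it is a projective generator. $\operatorname{End}({}_QP)$ is the quantale of endomorphisms of $P$ with pointwise order and product $h\cdot g=g\circ h$. For a right $Q$-module $M$ and a left $Q$-module $N$, $M\otimes_Q N$ denotes the tensor product, i.e. the complete lattice universal for maps from $M\times N$ that preserve arbitrary joins in each argument and are $Q$-balanced. If $N$ is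 a $Q$-$R$-bimodule, then $M\otimes_Q N$ is a right $R$-module by $(x\otimes y)r=x\otimes yr$. Given a left $Q$-module $P$ and an isomorphism of quantales $e:R\to\operatorname{End}({}_QP)$, $P$ is a $Q$-$R$-bimodule by $ur=e(r)(u)$, and the dual $P^*={}_Q\mathcal M(P,Q)$ is an $R$-$Q$-bimodule by $(rf)(u)=f(ur)$ and $(fq)(u)=f(u)q$. **Theorem.** Let $Q$ and $R$ be quantales. The following are equivalent: 1. $Q$ and $R$ are Morita equivalent, i.e. ${}_Q\mathcal M$ and ${}_R\mathcal M$ are equivalent categories; 2. $\mathcal M_Q$ and $\mathcal M_R$ are equivalent categories; 3. there is a progenerator $P$ for ${}_Q\mathcal M$ such that $R$ and $\operatorname{End}({}_QP)$ are isomorphic quantales. Moreover, for every progenerator $P$ for ${}_Q\mathcal M$ and every isomorphism of quantales $e:R\to\operatorname{End}({}_QP)$, the functors $-\otimes_Q P:\mathcal M_Q\to\mathcal M_R$ and $-\otimes_R P^*:\mathcal M_R\to\mathcal M_Q$ form an equivalence of categories, inverse to each other up to natural isomorphism. -/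

import Mathlib

open CategoryTheory MulOpposite

universe u

/-! ### Opposite quantales

A unital quantale is a type with `[Monoid Q] [CompleteLattice Q] [IsQuantale Q]`. As for rings, a
right action of `Q` is a left action of `Qᵐᵒᵖ`, which is again a quantale, for the same order. -/

section Opposite

variable {Q : Type*}

instance MulOpposite.instCompleteLatticeOfQuantale [CompleteLattice Q] :
    CompleteLattice Qᵐᵒᵖ :=
  { (inferInstance : PartialOrder Qᵐᵒᵖ) with
    sup := fun a b => op (unop a ⊔ unop b)
    le_sup_left := fun a b => (le_sup_left : unop a ≤ unop a ⊔ unop b)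
    le_sup_right := fun a b => (le_sup_right : unop b ≤ unop a ⊔ unop b)
    sup_le := fun a b c h k => (sup_le h k : unop a ⊔ unop b ≤ unop c)
    inf := fun a b => op (unop a ⊓ unop b)
    inf_le_left := fun a b => (inf_le_left : unop a ⊓ unop b ≤ unop a)
    inf_le_right := fun a b => (inf_le_right : unop a ⊓ unop b ≤ unop b)
    le_inf := fun a b c h k => (le_inf h k : unop a ≤ unop b ⊓ unop c)
    sSup := fun S => op (⨆ a ∈ S, unop a)
    isLUB_sSup := fun S => ⟨fun a ha => (le_iSup₂ (f := fun (b : Qᵐᵒᵖ) (_ : b ∈ S) => unop b) a ha),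
      fun b hb => (iSup₂_le fun a ha => hb ha : (⨆ a ∈ S, unop a) ≤ unop b)⟩
    sInf := fun S => op (⨅ a ∈ S, unop a)
    isGLB_sInf := fun S => ⟨fun a ha => (iInf₂_le (f := fun (b : Qᵐᵒᵖ) (_ : b ∈ S) => unop b) a ha),
      fun b hb => (le_iInf₂ fun a ha => hb ha : unop b ≤ ⨅ a ∈ S, unop a)⟩
    top := op ⊤
    le_top := fun a => (le_top : unop a ≤ ⊤)
    bot := op ⊥
    bot_le := fun a => (bot_le : ⊥ ≤ unop a) }

theorem MulOpposite.unop_sSup_eq [CompleteLattice Q] (S : Set Qᵐᵒᵖ) :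
    unop (sSup S) = ⨆ a ∈ S, unop a := rfl

theorem MulOpposite.unop_iSup_eq [CompleteLattice Q] {ι : Sort*} (f : ι → Qᵐᵒᵖ) :
    unop (⨆ i, f i) = ⨆ i, unop (f i) := by
  rw [iSup, MulOpposite.unop_sSup_eq, iSup_range]

instance MulOpposite.instIsQuantale [Monoid Q] [CompleteLattice Q] [IsQuantale Q] :
    IsQuantale Qᵐᵒᵖ where
  mul_sSup_distrib x S := unop_injective <| by
    simp only [unop_mul, MulOpposite.unop_sSup_eq, MulOpposite.unop_iSup_eq]
    rw [← sSup_image, sSup_mul_distrib, iSup_image]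
  sSup_mul_distrib S x := unop_injective <| by
    simp only [unop_mul, MulOpposite.unop_sSup_eq, MulOpposite.unop_iSup_eq]
    rw [← sSup_image, mul_sSup_distrib, iSup_image]

end Opposite

/-! ### Modules over a quantale -/

/-- A left module over the quantale `Q`: a sup-lattice `M` with a monoid action of `Q` that
distributes over arbitrary joins in both arguments. -/
class IsQuantaleModule (Q M : Type*) [Monoid Q] [CompleteLattice Q] [CompleteLattice M]
    [MulAction Q M] : Prop where
  smul_sSup (a : Q) (S : Set M) : a • sSup S = ⨆ u ∈ S, a • u
  sSup_smul (A : Set Q) (u : M) : sSup A • u = ⨆ a ∈ A, a • u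

section Modules

variable {Q M : Type*} [Monoid Q] [CompleteLattice Q]

theorem IsQuantaleModule.smul_iSup [CompleteLattice M] [MulAction Q M] [IsQuantaleModule Q M]
    {ι : Sort*} (a : Q) (f : ι → M) : a • (⨆ i, f i) = ⨆ i, a • f i := by
  rw [iSup, IsQuantaleModule.smul_sSup, iSup_range]

/-- The quantale `Q` as a left module over itself. -/
instance IsQuantaleModule.self [IsQuantale Q] : IsQuantaleModule Q Q where
  smul_sSup _ _ := mul_sSup_distrib
  sSup_smul _ _ := sSup_mul_distrib

/-- The quantale `Q` as a right module over itself. -/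
instance IsQuantaleModule.selfRight [IsQuantale Q] : IsQuantaleModule Qᵐᵒᵖ Q where
  smul_sSup _ _ := sSup_mul_distrib
  sSup_smul A u := by
    simp only [MulOpposite.smul_eq_mul_unop, MulOpposite.unop_sSup_eq]
    rw [← sSup_image, mul_sSup_distrib, iSup_image]

/-- The power `M ^ I`, with pointwise order and action. -/
instance IsQuantaleModule.pi {I : Type*} [CompleteLattice M] [MulAction Q M]
    [IsQuantaleModule Q M] : IsQuantaleModule Q (I → M) where
  smul_sSup a S := by
    funext i
    simp only [Pi.smul_apply, sSup_apply, iSup_apply, IsQuantaleModule.smul_iSup, iSup_subtype]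
  sSup_smul A u := by
    funext i
    simp only [Pi.smul_apply, iSup_apply, IsQuantaleModule.sSup_smul]

end Modules

/-- Homomorphisms of left `Q`-modules: join-preserving maps that preserve the action. -/
structure QModHom (Q M N : Type*) [Monoid Q] [CompleteLattice M] [CompleteLattice N]
    [MulAction Q M] [MulAction Q N] extends sSupHom M N where
  map_smul' (a : Q) (u : M) : toFun (a • u) = a • toFun u

namespace QModHom

section Basic

variable {Q M N L : Type*} [Monoid Q] [CompleteLattice M] [CompleteLattice N]
  [CompleteLattice L] [MulAction Q M] [MulAction Q N] [MulAction Q L]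

instance : FunLike (QModHom Q M N) M N where
  coe f := f.toFun
  coe_injective := by
    rintro ⟨⟨f, _⟩, _⟩ ⟨⟨g, _⟩, _⟩ h
    cases h
    rfl

@[ext]
theorem ext {f g : QModHom Q M N} (h : ∀ x, f x = g x) : f = g := DFunLike.ext f g h

theorem map_smul (f : QModHom Q M N) (a : Q) (u : M) : f (a • u) = a • f u := f.map_smul' a u

theorem map_sSup (f : QModHom Q M N) (S : Set M) : f (sSup S) = ⨆ u ∈ S, f u :=
  (f.map_sSup' S).trans sSup_image

theorem map_iSup (f : QModHom Q M N) {ι : Sort*} (g : ι → M) : f (⨆ i, g i) = ⨆ i, f (g i) := by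
  rw [iSup, map_sSup, iSup_range]

/-- Constructor from the join condition in indexed form. -/
def ofFun (f : M → N) (h : ∀ S : Set M, f (sSup S) = ⨆ u ∈ S, f u)
    (h' : ∀ (a : Q) (u : M), f (a • u) = a • f u) : QModHom Q M N where
  toFun := f
  map_sSup' S := (h S).trans sSup_image.symm
  map_smul' := h'

@[simp]
theorem ofFun_apply (f : M → N) (h h') (x : M) : (ofFun f h h' : QModHom Q M N) x = f x := rfl

/-- The identity. -/
def id (Q M : Type*) [Monoid Q] [CompleteLattice M] [MulAction Q M] : QModHom Q M M :=
  ofFun (fun x => x) (fun _ => sSup_eq_iSup) (fun _ _ => rfl)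

@[simp]
theorem id_apply (x : M) : QModHom.id Q M x = x := rfl

/-- The composite `g ∘ f`. -/
def comp (g : QModHom Q N L) (f : QModHom Q M N) : QModHom Q M L :=
  ofFun (fun x => g (f x)) (fun S => by simp only [map_sSup, map_iSup])
    (fun a u => by simp only [map_smul])

@[simp]
theorem comp_apply (g : QModHom Q N L) (f : QModHom Q M N) (x : M) : g.comp f x = g (f x) := rfl

/-- The pointwise order. -/
instance : PartialOrder (QModHom Q M N) :=
  PartialOrder.lift (fun f : QModHom Q M N => (f : M → N)) DFunLike.coe_injective

theorem le_def {f g : QModHom Q M N} : f ≤ g ↔ ∀ x, f x ≤ g x := Iff.rfl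

end Basic

section Lattice

variable {Q M N : Type*} [Monoid Q] [CompleteLattice Q] [CompleteLattice M] [CompleteLattice N]
  [MulAction Q M] [MulAction Q N] [IsQuantaleModule Q N]

/-- Pointwise joins. -/
instance : SupSet (QModHom Q M N) where
  sSup F := ofFun (fun x => ⨆ f ∈ F, f x)
    (fun S => by
      simp only [map_sSup]
      exact le_antisymm
        (iSup₂_le fun f hf => iSup₂_mono fun u _ => le_iSup₂ (f := fun g (_ : g ∈ F) => g u) f hf)
        (iSup₂_le fun u hu => iSup₂_mono fun f _ => le_iSup₂ (f := fun v (_ : v ∈ S) => f v) u hu))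
    (fun a u => by simp only [map_smul, IsQuantaleModule.smul_iSup])

theorem sSup_apply (F : Set (QModHom Q M N)) (x : M) : sSup F x = ⨆ f ∈ F, f x := rfl

/-- The sup-lattice of homomorphisms. -/
instance : CompleteLattice (QModHom Q M N) :=
  completeLatticeOfSup _ fun F =>
    ⟨fun f hf x => le_iSup₂ (f := fun (g : QModHom Q M N) (_ : g ∈ F) => g x) f hf,
      fun _ hg x => iSup₂_le fun _ hf => hg hf x⟩

theorem iSup_apply {ι : Sort*} (f : ι → QModHom Q M N) (x : M) : (⨆ i, f i) x = ⨆ i, f i x := by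
  rw [iSup, sSup_apply, iSup_range]

/-- An action on `N` commuting with that of `Q` acts pointwise on homomorphisms `M → N`. For `N = Q`
and the right multiplication this is `(f q) x = (f x) q`. -/
instance {S : Type*} [Monoid S] [CompleteLattice S] [MulAction S N] [IsQuantaleModule S N]
    [SMulCommClass Q S N] : MulAction S (QModHom Q M N) where
  smul s f := ofFun (fun x => s • f x)
    (fun T => by simp only [map_sSup, IsQuantaleModule.smul_iSup])
    (fun a u => by simp only [map_smul, smul_comm a s])
  one_smul f := ext fun x => one_smul S (f x)
  mul_smul s t f := ext fun x => mul_smul s t (f x)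

theorem smul_apply {S : Type*} [Monoid S] [CompleteLattice S] [MulAction S N]
    [IsQuantaleModule S N] [SMulCommClass Q S N] (s : S) (f : QModHom Q M N) (x : M) :
    (s • f) x = s • f x := rfl

instance {S : Type*} [Monoid S] [CompleteLattice S] [MulAction S N] [IsQuantaleModule S N]
    [SMulCommClass Q S N] : IsQuantaleModule S (QModHom Q M N) where
  smul_sSup s F := ext fun x => by
    simp only [smul_apply, sSup_apply, iSup_apply, IsQuantaleModule.smul_iSup]
  sSup_smul A f := ext fun x => by
    simp only [smul_apply, iSup_apply, IsQuantaleModule.sSup_smul]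

end Lattice

end QModHom

/-! ### The endomorphism quantale -/

/-- The endomorphisms of a left `Q`-module `M`, acting on the right of `M`. -/
def QEnd (Q M : Type*) [Monoid Q] [CompleteLattice M] [MulAction Q M] : Type _ :=
  QModHom Q M M

namespace QEnd

variable {Q M : Type*} [Monoid Q] [CompleteLattice Q] [CompleteLattice M] [MulAction Q M]
  [IsQuantaleModule Q M]

instance : FunLike (QEnd Q M) M M := inferInstanceAs (FunLike (QModHom Q M M) M M)

/-- The pointwise order. -/
instance : CompleteLattice (QEnd Q M) := inferInstanceAs (CompleteLattice (QModHom Q M M))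

/-- The product `h * g` is the composite `g ∘ h`, so that `M` is a right module over `QEnd Q M`. -/
instance : Monoid (QEnd Q M) where
  mul h g := QModHom.comp g h
  one := QModHom.id Q M
  mul_assoc _ _ _ := rfl
  one_mul _ := rfl
  mul_one _ := rfl

theorem mul_apply (h g : QEnd Q M) (x : M) : (h * g) x = g (h x) := rfl

theorem one_apply (x : M) : (1 : QEnd Q M) x = x := rfl

theorem sSup_apply (F : Set (QEnd Q M)) (x : M) : sSup F x = ⨆ f ∈ F, f x := rfl

theorem iSup_apply {ι : Sort*} (f : ι → QEnd Q M) (x : M) : (⨆ i, f i) x = ⨆ i, f i x :=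
  QModHom.iSup_apply f x

theorem map_iSup (f : QEnd Q M) {ι : Sort*} (g : ι → M) : f (⨆ i, g i) = ⨆ i, f (g i) :=
  QModHom.map_iSup f g

theorem map_smul (f : QEnd Q M) (a : Q) (x : M) : f (a • x) = a • f x := QModHom.map_smul f a x

instance : IsQuantale (QEnd Q M) where
  mul_sSup_distrib h F := DFunLike.ext _ _ fun x => by
    simp only [mul_apply, sSup_apply, iSup_apply]
  sSup_mul_distrib F h := DFunLike.ext _ _ fun x => by
    simp only [mul_apply, sSup_apply, iSup_apply, map_iSup]

end QEnd

/-! ### The categories of modules -/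

/-- Left `Q`-modules (with carrier in the universe of `Q`). -/
structure LMod (Q : Type u) [Monoid Q] [CompleteLattice Q] : Type (u + 1) where
  carrier : Type u
  [lattice : CompleteLattice carrier]
  [action : MulAction Q carrier]
  [isModule : IsQuantaleModule Q carrier]

namespace LMod

variable {Q : Type u} [Monoid Q] [CompleteLattice Q]

instance : CoeSort (LMod Q) (Type u) := ⟨LMod.carrier⟩

attribute [instance] LMod.lattice LMod.action LMod.isModule

instance : Category (LMod Q) where
  Hom M N := QModHom Q M N
  id M := QModHom.id Q M
  comp f g := QModHom.comp g f

end LMod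

/-- Right `Q`-modules. -/
abbrev RMod (Q : Type u) [Monoid Q] [CompleteLattice Q] : Type (u + 1) := LMod Qᵐᵒᵖ

/-- `Q`-`R`-bimodules: a left `Q`-module and right `R`-module on the same sup-lattice, with
`(a • u) • r = a • (u • r)`. -/
structure QBimod (Q R : Type u) [Monoid Q] [CompleteLattice Q] [Monoid R] [CompleteLattice R] :
    Type (u + 1) where
  carrier : Type u
  [lattice : CompleteLattice carrier]
  [left : MulAction Q carrier]
  [isLeft : IsQuantaleModule Q carrier]
  [right : MulAction Rᵐᵒᵖ carrier]
  [isRight : IsQuantaleModule Rᵐᵒᵖ carrier]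
  [comm : SMulCommClass Q Rᵐᵒᵖ carrier]

namespace QBimod

variable {Q R : Type u} [Monoid Q] [CompleteLattice Q] [Monoid R] [CompleteLattice R]

instance : CoeSort (QBimod Q R) (Type u) := ⟨QBimod.carrier⟩

attribute [instance] QBimod.lattice QBimod.left QBimod.isLeft QBimod.right QBimod.isRight
  QBimod.comm

end QBimod

/-- Two quantales are Morita equivalent if their categories of left modules are equivalent. -/
def MoritaEquivalent (Q R : Type u) [Monoid Q] [CompleteLattice Q] [Monoid R]
    [CompleteLattice R] : Prop :=
  Nonempty (LMod Q ≌ LMod R)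

/-! ### Progenerators -/

/-- `P` is projective: every homomorphism from `P` lifts through every surjective homomorphism. -/
def LMod.IsProjective {Q : Type u} [Monoid Q] [CompleteLattice Q] (P : LMod Q) : Prop :=
  ∀ (A B : LMod Q) (g : QModHom Q A B) (f : QModHom Q P B), Function.Surjective g →
    ∃ h : QModHom Q P A, g.comp h = f

/-- `M` is a generator: the free module `Q` is a retract of a power `M ^ I`. -/
def LMod.IsGenerator {Q : Type u} [Monoid Q] [CompleteLattice Q] (M : LMod Q) : Prop :=
  ∃ (I : Type u) (s : QModHom Q Q (I → M)) (r : QModHom Q (I → M) Q), r.comp s = QModHom.id Q Q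

/-- A progenerator is a projective generator. -/
def LMod.IsProgenerator {Q : Type u} [Monoid Q] [CompleteLattice Q] (P : LMod Q) : Prop :=
  P.IsProjective ∧ P.IsGenerator

/-! ### Tensor products

The tensor product of a right `Q`-module `M` and a left `Q`-module `N` is the quotient of the free
sup-lattice `Set (M × N)` by the congruence that identifies `{(⋁ X, y)}` with `X × {y}`,
`{(x, ⋁ Y)}` with `{x} × Y`, and `{(x a, y)}` with `{(x, a y)}`. Each class of this congruence has a
largest element, and the largest elements are the sets that contain one side of such a pair if and
only if they contain the other. -/

/-- The tensor product `M ⊗_Q N` of quantale modules, as the sup-lattice of saturated subsets of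
`M × N` ordered by inclusion. -/
structure QTensor (Q M N : Type*) [Monoid Q] [CompleteLattice M] [CompleteLattice N]
    [MulAction Qᵐᵒᵖ M] [MulAction Q N] where
  carrier : Set (M × N)
  sSup_left_mem (X : Set M) (y : N) : (sSup X, y) ∈ carrier ↔ ∀ x ∈ X, (x, y) ∈ carrier
  sSup_right_mem (x : M) (Y : Set N) : (x, sSup Y) ∈ carrier ↔ ∀ y ∈ Y, (x, y) ∈ carrier
  smul_mem (x : M) (a : Q) (y : N) : (op a • x, y) ∈ carrier ↔ (x, a • y) ∈ carrier

/-- `Q`-bimorphisms from `M × N` to a sup-lattice `L`: maps that preserve joins in each argument and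
are `Q`-balanced. -/
structure IsQBimorphism (Q : Type*) {M N L : Type*} [Monoid Q] [CompleteLattice M]
    [CompleteLattice N] [CompleteLattice L] [MulAction Qᵐᵒᵖ M] [MulAction Q N]
    (f : M → N → L) : Prop where
  map_sSup_left (X : Set M) (y : N) : f (sSup X) y = ⨆ x ∈ X, f x y
  map_sSup_right (x : M) (Y : Set N) : f x (sSup Y) = ⨆ y ∈ Y, f x y
  balanced (x : M) (a : Q) (y : N) : f (op a • x) y = f x (a • y)

namespace QTensor

section Basic

variable {Q M N L : Type*} [Monoid Q] [CompleteLattice M] [CompleteLattice N] [CompleteLattice L]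
  [MulAction Qᵐᵒᵖ M] [MulAction Q N]

theorem carrier_injective : Function.Injective (QTensor.carrier : QTensor Q M N → Set (M × N)) := by
  rintro ⟨_, _, _, _⟩ ⟨_, _, _, _⟩ h
  cases h
  rfl

instance : PartialOrder (QTensor Q M N) := PartialOrder.lift QTensor.carrier carrier_injective

theorem le_def {D E : QTensor Q M N} : D ≤ E ↔ D.carrier ⊆ E.carrier := Iff.rfl

instance : InfSet (QTensor Q M N) where
  sInf F :=
    { carrier := {p | ∀ D ∈ F, p ∈ D.carrier}
      sSup_left_mem := fun X y => by
        simp only [Set.mem_ofPred_eq, QTensor.sSup_left_mem]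
        exact ⟨fun h x hx D hD => h D hD x hx, fun h D hD x hx => h x hx D hD⟩
      sSup_right_mem := fun x Y => by
        simp only [Set.mem_ofPred_eq, QTensor.sSup_right_mem]
        exact ⟨fun h x hx D hD => h D hD x hx, fun h D hD x hx => h x hx D hD⟩
      smul_mem := fun x a y => by
        simp only [Set.mem_ofPred_eq, QTensor.smul_mem] }

instance : CompleteLattice (QTensor Q M N) :=
  completeLatticeOfInf _ fun F =>
    ⟨fun _ hD _ hp => hp _ hD, fun _ hE _ hp _ hD => hE hD hp⟩

/-- The pure tensor `x ⊗ y`. -/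
def tmul (Q : Type*) {M N : Type*} [Monoid Q] [CompleteLattice M] [CompleteLattice N]
    [MulAction Qᵐᵒᵖ M] [MulAction Q N] (x : M) (y : N) : QTensor Q M N :=
  sInf {D | (x, y) ∈ D.carrier}

theorem tmul_le {x : M} {y : N} {D : QTensor Q M N} : tmul Q x y ≤ D ↔ (x, y) ∈ D.carrier :=
  ⟨fun h => h (fun _ hE => hE : (x, y) ∈ (tmul Q x y).carrier), fun h => sInf_le h⟩

theorem isQBimorphism_tmul : IsQBimorphism Q (tmul Q : M → N → QTensor Q M N) where
  map_sSup_left X y := eq_of_forall_ge_iff fun D => by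
    simp only [tmul_le, iSup_le_iff, D.sSup_left_mem]
  map_sSup_right x Y := eq_of_forall_ge_iff fun D => by
    simp only [tmul_le, iSup_le_iff, D.sSup_right_mem]
  balanced x a y := eq_of_forall_ge_iff fun D => by simp only [tmul_le, D.smul_mem]

theorem eq_iSup_tmul (D : QTensor Q M N) : D = ⨆ p ∈ D.carrier, tmul Q p.1 p.2 :=
  le_antisymm
    (fun p hp => tmul_le.1 (le_iSup₂ (f := fun (p : M × N) (_ : p ∈ D.carrier) => tmul Q p.1 p.2)
      p hp))
    (iSup₂_le fun _ hp => tmul_le.2 hp)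

/-- The largest tensor sent below `l` by a bimorphism `f`. -/
def below {f : M → N → L} (hf : IsQBimorphism Q f) (l : L) : QTensor Q M N where
  carrier := {p | f p.1 p.2 ≤ l}
  sSup_left_mem X y := by simp only [Set.mem_ofPred_eq, hf.map_sSup_left, iSup_le_iff]
  sSup_right_mem x Y := by simp only [Set.mem_ofPred_eq, hf.map_sSup_right, iSup_le_iff]
  smul_mem x a y := by simp only [Set.mem_ofPred_eq, hf.balanced]

theorem gc {f : M → N → L} (hf : IsQBimorphism Q f) :
    GaloisConnection (fun D : QTensor Q M N => ⨆ p ∈ D.carrier, f p.1 p.2) (below hf) :=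
  fun _ _ => iSup₂_le_iff.trans ⟨fun h p hp => h p hp, fun h p hp => h hp⟩

/-- The join-preserving map induced by a bimorphism. -/
def lift {f : M → N → L} (hf : IsQBimorphism Q f) : sSupHom (QTensor Q M N) L where
  toFun D := ⨆ p ∈ D.carrier, f p.1 p.2
  map_sSup' S := (gc hf).l_sSup.trans sSup_image.symm

theorem lift_tmul {f : M → N → L} (hf : IsQBimorphism Q f) (x : M) (y : N) :
    lift hf (tmul Q x y) = f x y :=
  eq_of_forall_ge_iff fun l => (gc hf (tmul Q x y) l).trans tmul_le

theorem hom_ext {g h : sSupHom (QTensor Q M N) L}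
    (H : ∀ x y, g (tmul Q x y) = h (tmul Q x y)) : g = h := by
  refine DFunLike.ext g h fun D => ?_
  rw [eq_iSup_tmul D]
  simp only [_root_.map_iSup, H]

/-- The universal property of the tensor product. -/
theorem existsUnique_lift {f : M → N → L} (hf : IsQBimorphism Q f) :
    ∃! g : sSupHom (QTensor Q M N) L, ∀ x y, g (tmul Q x y) = f x y :=
  ⟨lift hf, lift_tmul hf, fun _ hg => hom_ext fun x y => (hg x y).trans (lift_tmul hf x y).symm⟩

end Basic

section Action

variable {Q M N S : Type*} [Monoid Q] [CompleteLattice Q] [CompleteLattice M] [CompleteLattice N]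
  [MulAction Qᵐᵒᵖ M] [MulAction Q N] [Monoid S] [CompleteLattice S] [MulAction S N]
  [IsQuantaleModule S N] [SMulCommClass Q S N]

theorem isQBimorphism_smul (s : S) :
    IsQBimorphism Q (fun (x : M) (y : N) => tmul Q x (s • y)) where
  map_sSup_left X y := isQBimorphism_tmul.map_sSup_left X (s • y)
  map_sSup_right x Y := by
    rw [IsQuantaleModule.smul_sSup, ← sSup_image, isQBimorphism_tmul.map_sSup_right, iSup_image]
  balanced x a y := by rw [isQBimorphism_tmul.balanced, smul_comm]

/-- An action on `N` commuting with that of `Q` acts on the tensor product by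
`s • (x ⊗ y) = x ⊗ (s • y)`. -/
instance : SMul S (QTensor Q M N) where
  smul s D := lift (isQBimorphism_smul s) D

theorem smul_tmul (s : S) (x : M) (y : N) : s • tmul Q x y = tmul Q x (s • y) :=
  lift_tmul (isQBimorphism_smul s) x y

theorem smul_sSup_eq (s : S) (F : Set (QTensor Q M N)) : s • sSup F = ⨆ D ∈ F, s • D :=
  (map_sSup (lift (isQBimorphism_smul (Q := Q) (M := M) (N := N) s)) F).trans sSup_image

theorem smul_iSup_eq (s : S) {ι : Sort*} (g : ι → QTensor Q M N) :
    s • (⨆ i, g i) = ⨆ i, s • g i := by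
  rw [iSup, smul_sSup_eq, iSup_range]

instance : MulAction S (QTensor Q M N) where
  one_smul D := by
    rw [eq_iSup_tmul D]
    simp only [smul_iSup_eq, smul_tmul, one_smul]
  mul_smul s t D := by
    rw [eq_iSup_tmul D]
    simp only [smul_iSup_eq, smul_tmul, mul_smul]

instance : IsQuantaleModule S (QTensor Q M N) where
  smul_sSup s F := smul_sSup_eq s F
  sSup_smul A D := by
    have h (s : S) : s • D = ⨆ p ∈ D.carrier, tmul Q p.1 (s • p.2) := rfl
    have key (p : M × N) : tmul Q p.1 (sSup A • p.2) = ⨆ s ∈ A, tmul Q p.1 (s • p.2) := by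
      rw [IsQuantaleModule.sSup_smul, ← sSup_image, isQBimorphism_tmul.map_sSup_right, iSup_image]
    simp only [h, key]
    exact le_antisymm
      (iSup₂_le fun p hp => iSup₂_mono fun s _ =>
        le_iSup₂ (f := fun (q : M × N) (_ : q ∈ D.carrier) => tmul Q q.1 (s • q.2)) p hp)
      (iSup₂_le fun s hs => iSup₂_mono fun p _ =>
        le_iSup₂ (f := fun (t : S) (_ : t ∈ A) => tmul Q p.1 (t • p.2)) s hs)

end Action

section Map

variable {Q M M' N S : Type*} [Monoid Q] [CompleteLattice M] [CompleteLattice M']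
  [CompleteLattice N] [MulAction Qᵐᵒᵖ M] [MulAction Qᵐᵒᵖ M'] [MulAction Q N]

theorem isQBimorphism_map (f : QModHom Qᵐᵒᵖ M M') :
    IsQBimorphism Q (fun (x : M) (y : N) => tmul Q (f x) y) where
  map_sSup_left X y := by
    rw [QModHom.map_sSup, ← sSup_image, isQBimorphism_tmul.map_sSup_left, iSup_image]
  map_sSup_right x Y := isQBimorphism_tmul.map_sSup_right (f x) Y
  balanced x a y := by rw [QModHom.map_smul, isQBimorphism_tmul.balanced]

/-- The homomorphism `f ⊗ N`, given by `x ⊗ y ↦ f x ⊗ y`. -/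
def map (N S : Type*) [CompleteLattice N] [MulAction Q N] [CompleteLattice Q] [Monoid S]
    [CompleteLattice S] [MulAction S N] [IsQuantaleModule S N] [SMulCommClass Q S N]
    (f : QModHom Qᵐᵒᵖ M M') : QModHom S (QTensor Q M N) (QTensor Q M' N) where
  toFun := lift (isQBimorphism_map f)
  map_sSup' := (lift (isQBimorphism_map f)).map_sSup'
  map_smul' s D := by
    change lift (isQBimorphism_map f) (s • D) = s • lift (isQBimorphism_map f) D
    rw [eq_iSup_tmul D]
    simp only [smul_iSup_eq, smul_tmul, _root_.map_iSup, lift_tmul]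

theorem map_tmul [CompleteLattice Q] [Monoid S] [CompleteLattice S] [MulAction S N]
    [IsQuantaleModule S N] [SMulCommClass Q S N] (f : QModHom Qᵐᵒᵖ M M') (x : M) (y : N) :
    map N S f (tmul Q x y) = tmul Q (f x) y :=
  lift_tmul (isQBimorphism_map f) x y

theorem map_ext [Monoid S] [MulAction S (QTensor Q M N)] {L : Type*} [CompleteLattice L]
    [MulAction S L] {g h : QModHom S (QTensor Q M N) L}
    (H : ∀ x y, g (tmul Q x y) = h (tmul Q x y)) : g = h :=
  QModHom.ext fun D => DFunLike.congr_fun (hom_ext (g := g.tosSupHom) (h := h.tosSupHom) H) D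

end Map

end QTensor

/-- The functor `- ⊗_Q B` from right `Q`-modules to right `R`-modules, for a `Q`-`R`-bimodule
`B`. -/
def tensorFunctor {Q R : Type u} [Monoid Q] [CompleteLattice Q] [Monoid R] [CompleteLattice R]
    (B : QBimod Q R) : RMod Q ⥤ RMod R where
  obj M := ⟨QTensor Q M B⟩
  map f := QTensor.map B Rᵐᵒᵖ f
  map_id M := QTensor.map_ext fun x y => QTensor.map_tmul _ x y
  map_comp {M M' M''} (f : QModHom Qᵐᵒᵖ M M') (g : QModHom Qᵐᵒᵖ M' M'') :=
    QTensor.map_ext fun x y =>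
      (QTensor.map_tmul (g.comp f) x y).trans
        ((congrArg (QTensor.map B Rᵐᵒᵖ g) (QTensor.map_tmul f x y)).trans
          (QTensor.map_tmul g (f x) y)).symm

/-! ### The bimodules attached to a module with a given endomorphism quantale -/

namespace LMod

variable {Q R : Type u} [Monoid Q] [CompleteLattice Q] [Monoid R] [CompleteLattice R]

/-- A left `Q`-module `P` with an isomorphism `e : R ≅ End P` is a `Q`-`R`-bimodule: `u r = e r u`.
-/
def toBimod (P : LMod Q) (e : R ≃*o QEnd Q P) : QBimod Q R :=
  letI act : MulAction Rᵐᵒᵖ P :=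
    { smul := fun r u => e (unop r) u
      one_smul := fun u => by
        change e 1 u = u
        rw [map_one, QEnd.one_apply]
      mul_smul := fun r s u => by
        change e (unop s * unop r) u = e (unop r) (e (unop s) u)
        rw [map_mul, QEnd.mul_apply] }
  { carrier := P
    right := act
    isRight :=
      { smul_sSup := fun r S => QModHom.map_sSup (e (unop r)) S
        sSup_smul := fun A u => by
          change e (unop (sSup A)) u = ⨆ r ∈ A, e (unop r) u
          simp only [MulOpposite.unop_sSup_eq, _root_.map_iSup, QEnd.iSup_apply] }
    comm := ⟨fun a r u => (QEnd.map_smul (e (unop r)) a u).symm⟩ }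

/-- The dual `P* = Hom(P, Q)` of a left `Q`-module `P` with an isomorphism `e : R ≅ End P` is an
`R`-`Q`-bimodule: `(r f) u = f (u r) = f (e r u)` and `(f q) u = (f u) q`. -/
def dualBimod [IsQuantale Q] (P : LMod Q) (e : R ≃*o QEnd Q P) : QBimod R Q :=
  letI act : MulAction R (QModHom Q P Q) :=
    { smul := fun r f => f.comp (e r)
      one_smul := fun f => QModHom.ext fun u => by
        change f (e 1 u) = f u
        rw [map_one, QEnd.one_apply]
      mul_smul := fun r s f => QModHom.ext fun u => by
        change f (e (r * s) u) = f (e s (e r u))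
        rw [map_mul, QEnd.mul_apply] }
  { carrier := QModHom Q P Q
    left := act
    isLeft :=
      { smul_sSup := fun r F => QModHom.ext fun u => by
          change sSup F (e r u) = (⨆ f ∈ F, QModHom.comp f (e r)) u
          simp only [QModHom.sSup_apply, QModHom.iSup_apply]
          rfl
        sSup_smul := fun A f => QModHom.ext fun u => by
          change f (e (sSup A) u) = (⨆ r ∈ A, QModHom.comp f (e r)) u
          simp only [sSup_eq_iSup, _root_.map_iSup, QEnd.iSup_apply, QModHom.iSup_apply,
            QModHom.map_iSup]
          rfl }
    right := inferInstanceAs (MulAction Qᵐᵒᵖ (QModHom Q P Q))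
    isRight := inferInstanceAs (IsQuantaleModule Qᵐᵒᵖ (QModHom Q P Q))
    comm := ⟨fun _ _ _ => rfl⟩ }

end LMod

/-! The three conditions are linked in a cycle: an equivalence of left modules yields a
progenerator, a progenerator yields an equivalence of right modules by tensoring, and an equivalence
of right modules is an equivalence of left modules over the opposite quantales. Running the first
two steps over the opposites then leads back to left modules.

From a progenerator `P` to tensor functors: projectivity gives a dual basis, which makes the unit of
`End P` a join of rank-one endomorphisms; the generator property makes the unit of `Q` a join of
values `r i (q i)` of functionals. Evaluation `P × P* → Q` and the rank-one pairing `P* × P → R` are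
compatible, and for compatible pairings whose unit is such a join the contraction `M ⊗ B ⊗ C → M`
has the inverse `m ↦ ⋁ m ⊗ q i ⊗ r i` (`QPairing.contract_bijective`). The two contractions are the
unit and counit of the equivalence.

From an equivalence to a progenerator: the candidate is the module corresponding to the free module
`R`. What is used of `R` must be expressed categorically. Surjections are preserved because they are
recognised by factorizations through monomorphisms (`LMod.surjective_map`), which gives
projectivity. The order of hom-sets is preserved because binary joins are computed through
biproducts (`LMod.mapOrderIso`); hence arbitrary joins of morphisms are preserved too, which gives
the generator property and makes the isomorphism of endomorphism monoids one of quantales. -/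

/-! ### Tensor products: computation with joins -/

namespace QTensor

section Induction

universe v w

variable {Q : Type*} {M : Type v} {N : Type w} [Monoid Q] [CompleteLattice M] [CompleteLattice N]
  [MulAction Qᵐᵒᵖ M] [MulAction Q N]

/-- A property of tensors that is closed under joins and holds for pure tensors holds always. -/
theorem induction_tmul {p : QTensor Q M N → Prop} (tmul : ∀ x y, p (tmul Q x y))
    (iSup : ∀ {ι : Type (max v w)} (g : ι → QTensor Q M N), (∀ i, p (g i)) → p (⨆ i, g i))
    (D : QTensor Q M N) : p D := by
  rw [eq_iSup_tmul D, iSup_subtype']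
  exact iSup _ fun _ => tmul _ _

theorem tmul_iSup_left {ι : Sort*} (g : ι → M) (y : N) :
    tmul Q (⨆ i, g i) y = ⨆ i, tmul Q (g i) y := by
  rw [iSup, isQBimorphism_tmul.map_sSup_left, iSup_range]

end Induction

end QTensor

/-! ### Monomorphisms, isomorphisms and surjections of modules -/

namespace LMod

variable {Q : Type u} [Monoid Q] [CompleteLattice Q]

/-- The underlying homomorphism of a morphism. -/
abbrev hom {M N : LMod Q} (f : M ⟶ N) : QModHom Q M N := f

theorem comp_apply {M N L : LMod Q} (f : M ⟶ N) (g : N ⟶ L) (x : M) :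
    hom (f ≫ g) x = hom g (hom f x) := rfl

theorem id_apply {M : LMod Q} (x : M) : hom (𝟙 M) x = x := rfl

/-- The inverse of a bijective homomorphism. -/
noncomputable def invOfBijective {M N : LMod Q} (f : QModHom Q M N) (hf : Function.Bijective f) :
    QModHom Q N M :=
  QModHom.ofFun (Equiv.ofBijective f hf).symm
    (fun S => hf.1 <| by
      rw [QModHom.map_iSup]
      simp only [QModHom.map_iSup, Equiv.ofBijective_apply_symm_apply f hf, sSup_eq_iSup])
    (fun a u => hf.1 <| by
      rw [QModHom.map_smul, Equiv.ofBijective_apply_symm_apply f hf,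
        Equiv.ofBijective_apply_symm_apply f hf])

/-- A bijective homomorphism is an isomorphism. -/
noncomputable def isoOfBijective {M N : LMod Q} (f : QModHom Q M N) (hf : Function.Bijective f) :
    M ≅ N where
  hom := f
  inv := invOfBijective f hf
  hom_inv_id := QModHom.ext fun x => (Equiv.ofBijective f hf).symm_apply_apply x
  inv_hom_id := QModHom.ext fun x => (Equiv.ofBijective f hf).apply_symm_apply x

theorem surjective_of_isIso {M N : LMod Q} (f : M ⟶ N) [IsIso f] : Function.Surjective (hom f) :=
  fun y => ⟨hom (inv f) y, by rw [← comp_apply, IsIso.inv_hom_id, id_apply]⟩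

theorem mono_of_injective {M N : LMod Q} (f : M ⟶ N) (hf : Function.Injective (hom f)) :
    Mono f :=
  ⟨fun _ _ h => QModHom.ext fun x => hf (DFunLike.congr_fun (F := QModHom Q _ _) h x)⟩

/-- The quantale `Q` as an object of the category of left `Q`-modules. -/
abbrev self (Q : Type u) [Monoid Q] [CompleteLattice Q] [IsQuantale Q] : LMod Q := ⟨Q⟩

/-- The homomorphism `a ↦ a • x` from `Q` to a module. -/
def toSpan [IsQuantale Q] (M : LMod Q) (x : M) : QModHom Q Q M :=
  QModHom.ofFun (fun a => a • x) (fun S => IsQuantaleModule.sSup_smul S x)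
    (fun a b => mul_smul a b x)

theorem toSpan_apply [IsQuantale Q] (M : LMod Q) (x : M) (a : Q) : M.toSpan x a = a • x := rfl

/-- The free module `Q` represents the underlying set: elements of `M` are separated by the
morphisms `a ↦ a • x` out of `Q`, evaluated at 1. -/
theorem injective_of_mono [IsQuantale Q] {M N : LMod Q} (f : M ⟶ N) [Mono f] :
    Function.Injective (hom f) := by
  intro x y h
  have key : (M.toSpan x : self Q ⟶ M) = M.toSpan y := by
    refine Mono.right_cancellation (f := f) (Z := self Q) _ _ (QModHom.ext fun (a : Q) => ?_)
    change hom f (a • x) = hom f (a • y)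
    rw [QModHom.map_smul, QModHom.map_smul, h]
  have := DFunLike.congr_fun (F := QModHom Q Q M) key 1
  simpa only [toSpan_apply, one_smul] using this

/-! ### The image of a homomorphism as a module -/

section Range

variable {M N : LMod Q} (f : QModHom Q M N)

/-- The join of chosen preimages maps to the join of the images, so the image is closed under the
joins of `N`. -/
instance : SupSet (Set.range f) where
  sSup S := ⟨⨆ x ∈ S, x.1, ⨆ x ∈ S, x.2.choose, by
    simp only [QModHom.map_iSup]
    exact iSup_congr fun x => iSup_congr fun _ => x.2.choose_spec⟩

instance : CompleteLattice (Set.range f) :=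
  completeLatticeOfSup _ fun S =>
    ⟨fun x hx => Subtype.coe_le_coe.1 (le_iSup₂ (f := fun (y : Set.range f) (_ : y ∈ S) => y.1) x hx),
      fun _ hb => Subtype.coe_le_coe.1 (iSup₂_le fun _ hx => Subtype.coe_le_coe.2 (hb hx))⟩

theorem range_coe_sSup (S : Set (Set.range f)) : ((sSup S : Set.range f) : N) = ⨆ x ∈ S, x.1 := rfl

theorem range_coe_iSup {ι : Sort*} (g : ι → Set.range f) :
    ((⨆ i, g i : Set.range f) : N) = ⨆ i, (g i).1 := by
  rw [iSup, range_coe_sSup, iSup_range]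

instance : MulAction Q (Set.range f) where
  smul a x := ⟨a • x.1, a • x.2.choose, by rw [QModHom.map_smul, x.2.choose_spec]⟩
  one_smul x := Subtype.ext (one_smul Q x.1)
  mul_smul a b x := Subtype.ext (mul_smul a b x.1)

theorem range_coe_smul (a : Q) (x : Set.range f) : ((a • x : Set.range f) : N) = a • x.1 := rfl

instance : IsQuantaleModule Q (Set.range f) where
  smul_sSup a S := Subtype.ext <| by
    simp only [range_coe_smul, range_coe_sSup, range_coe_iSup, IsQuantaleModule.smul_iSup]
  sSup_smul A x := Subtype.ext <| by
    simp only [range_coe_smul, range_coe_iSup, IsQuantaleModule.sSup_smul]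

/-- The image of a homomorphism. -/
def range : LMod Q := ⟨Set.range f⟩

/-- The inclusion of the image. -/
def rangeInclusion : QModHom Q (range f) N :=
  QModHom.ofFun (fun x : Set.range f => x.1) (fun S => range_coe_sSup f S) (fun _ _ => rfl)

/-- The corestriction to the image. -/
def rangeFactorization : QModHom Q M (range f) :=
  QModHom.ofFun (Set.rangeFactorization f)
    (fun S => Subtype.ext <| (f.map_sSup S).trans <| by
      have h : ((⨆ u ∈ S, Set.rangeFactorization f u : Set.range f) : N) = ⨆ u ∈ S, f u := by
        simp only [range_coe_iSup]
        rfl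
      exact h.symm)
    (fun a u => Subtype.ext (f.map_smul a u))

end Range

end LMod

/-- Equivalences of module categories preserve surjections. -/
theorem LMod.surjective_map {Q R : Type u} [Monoid Q] [CompleteLattice Q] [IsQuantale Q]
    [Monoid R] [CompleteLattice R] (F : LMod Q ≌ LMod R)
    {A B : LMod Q} (g : A ⟶ B) (hg : Function.Surjective (hom g)) :
    Function.Surjective (hom (F.functor.map g)) := by
  -- Factor the image of `g` through its range and carry the inclusion `i` back to a monomorphism
  -- `j` into `B`. Since `g` factors through `j`, the latter is surjective, hence bijective, hence
  -- an isomorphism; then so is `i`, and the range is everything.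
  let f : F.functor.obj A ⟶ F.functor.obj B := F.functor.map g
  let i : range (hom f) ⟶ F.functor.obj B := rangeInclusion (hom f)
  let p : F.functor.obj A ⟶ range (hom f) := rangeFactorization (hom f)
  have hpi : p ≫ i = f := rfl
  have : Mono i := mono_of_injective i Subtype.val_injective
  let j : F.inverse.obj (range (hom f)) ⟶ B := F.inverse.map i ≫ F.unitInv.app B
  have hj : (F.unit.app A ≫ F.inverse.map p) ≫ j = g := by
    simp only [j, Category.assoc, ← F.inverse.map_comp_assoc, hpi, f]
    simp
  have hsurj : Function.Surjective (hom j) := by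
    intro y
    obtain ⟨x, hx⟩ := hg y
    refine ⟨hom (F.unit.app A ≫ F.inverse.map p) x, ?_⟩
    rw [← comp_apply, hj, hx]
  have : Mono j := inferInstance
  have hiso : IsIso j := (isoOfBijective (hom j) ⟨injective_of_mono j, hsurj⟩).isIso_hom
  have : IsIso (F.inverse.map i) := by
    have h : F.inverse.map i = j ≫ F.unit.app B := by simp [j]
    rw [h]
    infer_instance
  have : IsIso i := isIso_of_reflects_iso i F.inverse
  intro y
  obtain ⟨⟨_, x, rfl⟩, hx⟩ := surjective_of_isIso i y
  exact ⟨x, hx⟩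

/-! ### Morita pairings -/

section Pairing

variable {Q R : Type u} [Monoid Q] [CompleteLattice Q] [IsQuantale Q]
  [Monoid R] [CompleteLattice R]

/-- A pairing `B × C → Q` of a `Q`-`R`-bimodule and an `R`-`Q`-bimodule that is a bimorphism over `R`
and linear over `Q` on both sides. -/
structure QPairing (B : QBimod Q R) (C : QBimod R Q) where
  toFun : B → C → Q
  bimorphism : IsQBimorphism R toFun
  smul_left (a : Q) (u : B) (f : C) : toFun (a • u) f = a * toFun u f
  smul_right (u : B) (f : C) (a : Q) : toFun u (op a • f) = toFun u f * a

namespace QPairing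

variable {B : QBimod Q R} {C : QBimod R Q} (φ : QPairing B C) (M : RMod Q)

/-- Contraction of `(M ⊗ B) ⊗ C` is built by two successive lifts. This is the inner one, with the
variable from `C` held fixed; the next lemma lets that variable move. -/
theorem isQBimorphism_inner (f : C) :
    IsQBimorphism Q (fun (m : M) (u : B) => op (φ.toFun u f) • m) where
  map_sSup_left X u := IsQuantaleModule.smul_sSup _ X
  map_sSup_right m Y := by
    have h : op (⨆ u ∈ Y, φ.toFun u f) = ⨆ u ∈ Y, op (φ.toFun u f) :=
      unop_injective (by simp only [unop_iSup_eq, unop_op])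
    rw [φ.bimorphism.map_sSup_left, h, ← sSup_image, IsQuantaleModule.sSup_smul, iSup_image]
  balanced m a u := by rw [φ.smul_left, op_mul, mul_smul]

theorem isQBimorphism_outer :
    IsQBimorphism R (fun (D : QTensor Q M B) (f : C) =>
      QTensor.lift (φ.isQBimorphism_inner M f) D) where
  map_sSup_left X f := (map_sSup _ X).trans sSup_image
  map_sSup_right D Y := by
    have h (u : B) : op (φ.toFun u (sSup Y)) = sSup ((fun f => op (φ.toFun u f)) '' Y) := by
      rw [sSup_image, φ.bimorphism.map_sSup_right]
      exact unop_injective (by simp only [unop_iSup_eq, unop_op])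
    induction D using QTensor.induction_tmul with
    | tmul m u =>
      simp only [QTensor.lift_tmul]
      rw [h, IsQuantaleModule.sSup_smul, iSup_image]
    | iSup g ih =>
      simp only [_root_.map_iSup, ih]
      rw [iSup_comm]
      exact iSup_congr fun f => iSup_comm
  balanced D r f := by
    induction D using QTensor.induction_tmul with
    | tmul m u =>
      rw [QTensor.smul_tmul, QTensor.lift_tmul, QTensor.lift_tmul, φ.bimorphism.balanced]
    | iSup g ih => simp only [QTensor.smul_iSup_eq, _root_.map_iSup, ih]

/-- The homomorphism `(M ⊗ B) ⊗ C → M`, `(m ⊗ u) ⊗ f ↦ m φ(u, f)`. -/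
def contract : QModHom Qᵐᵒᵖ (QTensor R (QTensor Q M B) C) M where
  toFun := QTensor.lift (φ.isQBimorphism_outer M)
  map_sSup' := (QTensor.lift (φ.isQBimorphism_outer M)).map_sSup'
  map_smul' s D := by
    change QTensor.lift (φ.isQBimorphism_outer M) (s • D) =
      s • QTensor.lift (φ.isQBimorphism_outer M) D
    induction D using QTensor.induction_tmul with
    | tmul D f =>
      simp only [QTensor.smul_tmul, QTensor.lift_tmul]
      induction D using QTensor.induction_tmul with
      | tmul m u =>
        simp only [QTensor.lift_tmul]
        rw [← op_unop s, φ.smul_right, op_mul, mul_smul]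
      | iSup g ih => simp only [_root_.map_iSup, ih, IsQuantaleModule.smul_iSup]
    | iSup g ih => simp only [_root_.map_iSup, ih, IsQuantaleModule.smul_iSup]

theorem contract_tmul (m : M) (u : B) (f : C) :
    φ.contract M (QTensor.tmul R (QTensor.tmul Q m u) f) = op (φ.toFun u f) • m :=
  (QTensor.lift_tmul (φ.isQBimorphism_outer M) _ f).trans (QTensor.lift_tmul _ m u)


/-- If the unit of `Q` is a join of values of a pairing that is compatible with a pairing
`C × B → R`, contraction is bijective. -/
theorem contract_bijective (ψ : C → B → R) (h₁ : ∀ u f v, φ.toFun u f • v = op (ψ f v) • u)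
    (h₂ : ∀ f v g, ψ f v • g = op (φ.toFun v g) • f) {ι : Type*} (q : ι → B) (r : ι → C)
    (h : ⨆ i, φ.toFun (q i) (r i) = 1) : Function.Bijective (φ.contract M) := by
  have hop : (⨆ i, op (φ.toFun (q i) (r i))) = 1 :=
    unop_injective (by simp only [unop_iSup_eq, unop_op, h, unop_one])
  have sum {N : Type u} [CompleteLattice N] [MulAction Qᵐᵒᵖ N] [IsQuantaleModule Qᵐᵒᵖ N] (m : N) :
      (⨆ i, op (φ.toFun (q i) (r i)) • m) = m := by
    rw [← iSup_range (g := fun a : Qᵐᵒᵖ => a • m), ← IsQuantaleModule.sSup_smul, ← iSup, hop,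
      one_smul]
  -- The inverse of contraction is `m ↦ ⋁ (m ⊗ q i) ⊗ r i`.
  have left (D : QTensor R (QTensor Q M B) C) :
      (⨆ i, QTensor.tmul R (QTensor.tmul Q (φ.contract M D) (q i)) (r i)) = D := by
    induction D using QTensor.induction_tmul with
    | tmul D f =>
      induction D using QTensor.induction_tmul with
      | tmul m u =>
        -- Scalars travel across both tensor signs: `m φ(u,f) ⊗ q ⊗ r = m ⊗ φ(u,f) q ⊗ r = m ⊗ u
        -- ψ(f,q) ⊗ r = m ⊗ u ⊗ ψ(f,q) r = m ⊗ u ⊗ f φ(q,r)`. The join over `i` of the last factors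
        -- is the unit.
        simp only [contract_tmul, QTensor.isQBimorphism_tmul.balanced, h₁]
        simp only [← QTensor.smul_tmul, QTensor.isQBimorphism_tmul.balanced, h₂]
        exact sum _
      | iSup g ih =>
        simp only [QTensor.tmul_iSup_left, QModHom.map_iSup]
        rw [iSup_comm]
        exact iSup_congr ih
    | iSup g ih =>
      simp only [QModHom.map_iSup, QTensor.tmul_iSup_left]
      rw [iSup_comm]
      exact iSup_congr ih
  refine ⟨fun D E hDE => by rw [← left D, hDE, left], fun m =>
    ⟨⨆ i, QTensor.tmul R (QTensor.tmul Q m (q i)) (r i), ?_⟩⟩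
  simp only [QModHom.map_iSup, contract_tmul, sum]

theorem contract_map {M N : RMod Q} (f : QModHom Qᵐᵒᵖ M N)
    (D : QTensor R (QTensor Q M B) C) :
    φ.contract N (QTensor.map C Qᵐᵒᵖ (QTensor.map B Rᵐᵒᵖ f) D) = f (φ.contract M D) := by
  induction D using QTensor.induction_tmul with
  | tmul D g =>
    induction D using QTensor.induction_tmul with
    | tmul m u =>
      rw [QTensor.map_tmul, QTensor.map_tmul, contract_tmul, contract_tmul, QModHom.map_smul]
    | iSup g ih => simp only [QTensor.tmul_iSup_left, QModHom.map_iSup, ih]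
  | iSup g ih => simp only [QModHom.map_iSup, ih]

/-- The natural isomorphism given by contraction. -/
noncomputable def contractIso (h : ∀ M : RMod Q, Function.Bijective (φ.contract M)) :
    tensorFunctor B ⋙ tensorFunctor C ≅ 𝟭 (RMod Q) :=
  NatIso.ofComponents (fun M => LMod.isoOfBijective (N := M) (φ.contract M) (h M))
    (fun {M N} f => QModHom.ext (Q := Qᵐᵒᵖ) fun D => φ.contract_map f D)

end QPairing

end Pairing

/-! ### Progenerators -/

theorem IsQuantaleModule.iSup_smul {Q M : Type*} [Monoid Q] [CompleteLattice Q]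
    [CompleteLattice M] [MulAction Q M] [IsQuantaleModule Q M] {ι : Sort*} (g : ι → Q) (x : M) :
    (⨆ i, g i) • x = ⨆ i, g i • x := by
  rw [iSup, IsQuantaleModule.sSup_smul, iSup_range]

namespace LMod

/-! ### Dual bases and the unit as a join of values -/

section Bases

variable {Q : Type u} [Monoid Q] [CompleteLattice Q] [IsQuantale Q]

/-- The homomorphism from a free module given by a family of elements. -/
def ofFamily {I : Type*} (M : LMod Q) (x : I → M) : QModHom Q (I → Q) M :=
  QModHom.ofFun (fun a => ⨆ i, a i • x i)
    (fun S => by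
      simp only [sSup_eq_iSup, _root_.iSup_apply, IsQuantaleModule.iSup_smul]
      rw [iSup_comm]
      exact iSup_congr fun a => iSup_comm)
    (fun a c => by simp only [Pi.smul_apply, smul_eq_mul, mul_smul, IsQuantaleModule.smul_iSup])

theorem ofFamily_apply {I : Type*} (M : LMod Q) (x : I → M) (a : I → Q) :
    M.ofFamily x a = ⨆ i, a i • x i := rfl

/-- A projective module has a dual basis. -/
theorem IsProjective.exists_dualBasis {P : LMod Q} (hP : P.IsProjective) :
    ∃ f : P → QModHom Q P Q, ∀ u : P, ⨆ i, f i u • i = u := by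
  -- The power `Q ^ P` is free on the underlying set of `P`. A section `h` of the canonical
  -- surjection onto `P` exists by projectivity, and its coordinates are the dual basis.
  obtain ⟨h, hh⟩ := hP ⟨P → Q⟩ P (P.ofFamily fun u => u) (QModHom.id Q P) fun u =>
    -- The preimage of `u` is its indicator function: 1 at `u` and the empty join `⊥` elsewhere.
    ⟨fun v => ⨆ _ : u = v, 1, by
      rw [ofFamily_apply]
      refine le_antisymm (iSup_le fun v => ?_) (le_iSup_of_le u ?_)
      · by_cases hv : u = v
        · simp [hv]
        · simp only [hv, iSup_false]
          rw [← sSup_empty, IsQuantaleModule.sSup_smul]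
          simp
      · simp⟩
  refine ⟨fun i => QModHom.ofFun (fun u => h u i) (fun S => by simp [QModHom.map_sSup])
    (fun a u => by rw [QModHom.map_smul]; rfl), fun u => ?_⟩
  exact DFunLike.congr_fun hh u

/-- For a generator, the unit of `Q` is a join of values of functionals. -/
theorem IsGenerator.exists_iSup_eq_one {P : LMod Q} (hP : P.IsGenerator) :
    ∃ (I : Type u) (q : I → P) (r : I → QModHom Q P Q), ⨆ i, r i (q i) = 1 := by
  classical
  obtain ⟨I, s, r, h⟩ := hP
  have hbot (a : Q) : a • (⊥ : P) = ⊥ := by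
    rw [← sSup_empty, IsQuantaleModule.smul_sSup]; simp
  -- Powers are also copowers: `Function.update ⊥ i` is the `i`-th coproduct inclusion. The points
  -- are the coordinates of `s 1`, and the functionals are the components of `r` on the summands.
  refine ⟨I, s 1, fun i => QModHom.ofFun (fun u => r (Function.update ⊥ i u)) (fun S => ?_)
    (fun a u => ?_), ?_⟩
  · simp only [← QModHom.map_iSup]
    congr 1
    ext j
    simp only [_root_.iSup_apply]
    by_cases hj : j = i
    · subst hj; simp [sSup_eq_iSup]
    · simp [hj]
  · rw [← QModHom.map_smul]
    congr 1
    ext j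
    by_cases hj : j = i
    · subst hj; simp
    · simp [hj, hbot]
  · simp only [QModHom.ofFun_apply]
    rw [← QModHom.map_iSup]
    -- An element of a power is the join of its coordinates placed in their summands.
    have : (⨆ i, Function.update ⊥ i (s 1 i)) = s 1 := by
      ext j
      rw [_root_.iSup_apply]
      refine le_antisymm (iSup_le fun i => ?_) (le_iSup_of_le j (by simp))
      by_cases hj : j = i
      · subst hj; simp
      · simp [hj]
    rw [this]
    exact DFunLike.congr_fun h 1

/-- A module is a generator if the unit is a join of values of functionals. -/
theorem isGenerator_of_iSup_eq_one {P : LMod Q} {I : Type u} (q : I → P) (r : I → QModHom Q P Q)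
    (h : ⨆ i, r i (q i) = 1) : P.IsGenerator := by
  refine ⟨I, QModHom.ofFun (fun a i => a • q i) (fun S => ?_) (fun a c => ?_),
    QModHom.ofFun (fun x => ⨆ i, r i (x i)) (fun S => ?_) (fun a x => ?_), QModHom.ext fun a => ?_⟩
  · ext i
    simp only [IsQuantaleModule.sSup_smul, _root_.iSup_apply]
  · ext i
    exact mul_smul a c (q i)
  · simp only [sSup_eq_iSup, _root_.iSup_apply, QModHom.map_iSup]
    rw [iSup_comm]
    exact iSup_congr fun x => iSup_comm
  · simp only [Pi.smul_apply, QModHom.map_smul, IsQuantaleModule.smul_iSup]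
  · simp only [QModHom.comp_apply, QModHom.ofFun_apply, QModHom.map_smul, QModHom.id_apply]
    rw [← IsQuantaleModule.smul_iSup, h, smul_eq_mul, mul_one]

end Bases

/-! ### The pairings between a progenerator and its dual -/

section Moreover

variable {Q R : Type u} [Monoid Q] [CompleteLattice Q] [IsQuantale Q]
  [Monoid R] [CompleteLattice R] [IsQuantale R] (P : LMod Q) (e : R ≃*o QEnd Q P)

theorem toBimod_smul (r : R) (u : P.toBimod e) : (op r • u : P.toBimod e) = e r u := rfl

theorem dualBimod_smul (r : R) (f : P.dualBimod e) :
    (r • f : P.dualBimod e) = QModHom.comp (show QModHom Q P Q from f) (e r) := rfl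

/-- The evaluation pairing `P × P* → Q`. -/
def evalPairing : QPairing (P.toBimod e) (P.dualBimod e) where
  toFun u f := (show QModHom Q P Q from f) u
  bimorphism :=
    { map_sSup_left := fun X f => QModHom.map_sSup (show QModHom Q P Q from f) X
      map_sSup_right := fun _ _ => rfl
      balanced := fun _ _ _ => rfl }
  smul_left a u f := QModHom.map_smul (show QModHom Q P Q from f) a u
  smul_right _ _ _ := rfl

/-- The endomorphism `x ↦ f(x) • u`. -/
def rankOne (f : QModHom Q P Q) (u : P) : QEnd Q P := (P.toSpan u).comp f

/-- The pairing `P* × P → R`, sending `(f, u)` to the element acting by `x ↦ f(x) • u`. -/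
def coevalPairing : QPairing (P.dualBimod e) (P.toBimod e) where
  toFun f u := e.symm (P.rankOne f u)
  bimorphism :=
    { map_sSup_left := fun X u => by
        simp only [← _root_.map_iSup]
        refine congrArg e.symm (DFunLike.ext _ _ fun x => ?_)
        simp only [QEnd.iSup_apply]
        change (⨆ f ∈ X, (show QModHom Q P Q from f) x) • u = _
        simp only [IsQuantaleModule.iSup_smul]
        rfl
      map_sSup_right := fun f Y => by
        simp only [← _root_.map_iSup]
        refine congrArg e.symm (DFunLike.ext _ _ fun x => ?_)
        simp only [QEnd.iSup_apply]
        exact IsQuantaleModule.smul_sSup _ Y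
      balanced := fun f a u => congrArg e.symm (DFunLike.ext _ _ fun x => mul_smul _ _ _) }
  smul_left r f u := by
    -- Pulling `r` through `e` reduces the claim to endomorphisms: both sides are `x ↦ f (x r) • u`.
    rw [← e.symm_apply_apply r, ← map_mul, e.symm_apply_apply]
    rfl
  smul_right f u r := by
    rw [← e.symm_apply_apply r, ← map_mul, e.symm_apply_apply]
    exact congrArg e.symm (DFunLike.ext _ _ fun x => (QEnd.map_smul (e r) _ u).symm)

/-- For a progenerator `P` with endomorphism quantale `R`, the functors `- ⊗_Q P` and `- ⊗_R P*`
form an equivalence. -/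
theorem IsProgenerator.exists_equivalence {P : LMod Q} (hP : P.IsProgenerator)
    (e : R ≃*o QEnd Q P) : ∃ E : RMod Q ≌ RMod R,
      E.functor = tensorFunctor (P.toBimod e) ∧ E.inverse = tensorFunctor (P.dualBimod e) := by
  obtain ⟨f, hf⟩ := hP.1.exists_dualBasis
  obtain ⟨I, q, r, hqr⟩ := hP.2.exists_iSup_eq_one
  -- Both sides are the functional `x ↦ g(x) k(u)`.
  have h₁ (g : P.dualBimod e) (u : P.toBimod e) (k : P.dualBimod e) :
      (P.coevalPairing e).toFun g u • k = op ((P.evalPairing e).toFun u k) • g := by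
    rw [dualBimod_smul]
    change QModHom.comp _ (e (e.symm _)) = _
    rw [OrderMonoidIso.apply_symm_apply]
    exact QModHom.ext fun x => QModHom.map_smul (show QModHom Q P Q from k) _ _
  -- Both sides are `g(u) • v`.
  have h₂ (u : P.toBimod e) (g : P.dualBimod e) (v : P.toBimod e) :
      (P.evalPairing e).toFun u g • v = op ((P.coevalPairing e).toFun g v) • u := by
    rw [toBimod_smul]
    change _ = e (e.symm _) u
    rw [OrderMonoidIso.apply_symm_apply]
    rfl
  -- The evaluation contraction is invertible by the generator property, the rank-one contraction by
  -- projectivity. `Equivalence.mk` may adjust the unit isomorphism but keeps both functors, so the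
  -- two final equalities are definitional.
  refine ⟨CategoryTheory.Equivalence.mk _ _
    ((P.evalPairing e).contractIso fun M => (P.evalPairing e).contract_bijective M
      (P.coevalPairing e).toFun h₂ h₁ q r hqr).symm
    ((P.coevalPairing e).contractIso fun M => (P.coevalPairing e).contract_bijective M
      (P.evalPairing e).toFun h₁ h₂ f (fun u => u) ?_), rfl, rfl⟩
  -- The dual basis identity says that these rank-one endomorphisms have the identity of `P` as
  -- their join.
  change ⨆ u, e.symm (P.rankOne (f u) u) = 1
  rw [← _root_.map_iSup, ← map_one e.symm]
  refine congrArg e.symm (DFunLike.ext _ _ fun x => ?_)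
  rw [QEnd.iSup_apply]
  exact hf x

end Moreover

end LMod

/-! ### Equivalences preserve the order of homomorphisms -/

namespace LMod

variable {Q R : Type u} [Monoid Q] [CompleteLattice Q] [Monoid R] [CompleteLattice R]

/-- A categorical description of joins of two morphisms: `h` factors through the codiagonal of a
biproduct `N ⊕ N` by the morphism with components `f` and `g`. -/
def IsBiproductSum {M N : LMod Q} (f g h : M ⟶ N) : Prop :=
  ∃ (X : LMod Q) (i j : N ⟶ X) (p q d : X ⟶ N) (k : M ⟶ X) (z : N ⟶ N),
    (∀ a b : N ⟶ N, a ≫ z = b ≫ z) ∧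
    (∀ a b : X ⟶ N, i ≫ a = i ≫ b → j ≫ a = j ≫ b → a = b) ∧
    i ≫ p = 𝟙 N ∧ i ≫ q = z ∧ j ≫ p = z ∧ j ≫ q = 𝟙 N ∧ i ≫ d = 𝟙 N ∧ j ≫ d = 𝟙 N ∧
    k ≫ p = f ∧ k ≫ q = g ∧ k ≫ d = h

/-- Apart from equations between composites, the description quantifies over morphisms between `N`
and `X`. Fullness brings those in the target category back to the source, and faithfulness reflects
the hypotheses of the joint-epimorphism clause. -/
theorem IsBiproductSum.map {M N : LMod Q} {f g h : M ⟶ N} (H : IsBiproductSum f g h)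
    (F : LMod Q ⥤ LMod R) [F.Full] [F.Faithful] :
    IsBiproductSum (F.map f) (F.map g) (F.map h) := by
  obtain ⟨X, i, j, p, q, d, k, z, hz, hX, h₁, h₂, h₃, h₄, h₅, h₆, h₇, h₈, h₉⟩ := H
  refine ⟨F.obj X, F.map i, F.map j, F.map p, F.map q, F.map d, F.map k, F.map z,
    fun a b => ?_, fun a b ha hb => ?_, ?_⟩
  · obtain ⟨a, rfl⟩ := F.map_surjective a
    obtain ⟨b, rfl⟩ := F.map_surjective b
    rw [← F.map_comp, ← F.map_comp, hz]
  · obtain ⟨a, rfl⟩ := F.map_surjective a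
    obtain ⟨b, rfl⟩ := F.map_surjective b
    rw [← F.map_comp, ← F.map_comp] at ha hb
    rw [hX a b (F.map_injective ha) (F.map_injective hb)]
  · simp only [← F.map_comp, ← F.map_id, h₁, h₂, h₃, h₄, h₅, h₆, h₇, h₈, h₉, and_self]

theorem sup_apply {M N : LMod Q} (f g : QModHom Q M N) (x : M) : (f ⊔ g) x = f x ⊔ g x := by
  rw [← sSup_pair, QModHom.sSup_apply, iSup_pair]

theorem bot_apply {M N : LMod Q} (x : M) : (⊥ : QModHom Q M N) x = ⊥ := by
  rw [← sSup_empty, QModHom.sSup_apply, iSup_emptyset]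

theorem map_bot {M N : LMod Q} (f : QModHom Q M N) : f ⊥ = ⊥ := by
  rw [← sSup_empty, QModHom.map_sSup, iSup_emptyset]

theorem map_sup {M N : LMod Q} (f : QModHom Q M N) (x y : M) : f (x ⊔ y) = f x ⊔ f y := by
  rw [← sSup_pair, QModHom.map_sSup, iSup_pair]

/-- The codiagonal `d` is forced to be `p ⊔ q`, since both restrict to the identity along the
jointly epimorphic `i` and `j`. Precomposing with `k` gives the join of `f` and `g`. -/
theorem IsBiproductSum.eq_sup {M N : LMod Q} {f g h : M ⟶ N} (H : IsBiproductSum f g h) :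
    hom h = hom f ⊔ hom g := by
  obtain ⟨X, i, j, p, q, d, k, z, hz, hX, h₁, h₂, h₃, h₄, h₅, h₆, rfl, rfl, rfl⟩ := H
  -- Comparing the identity with the bottom endomorphism in `hz` shows that `z` is the zero
  -- morphism.
  have hz0 (x : N) : hom z x = ⊥ := by
    have h := hz (𝟙 N) (⊥ : QModHom Q N N)
    have := DFunLike.congr_fun (F := QModHom Q N N) h x
    rw [← map_bot (hom z), ← bot_apply (M := N) (N := N) x]
    exact this
  have app {A B : LMod Q} {a b : A ⟶ B} (h : a = b) (x : A) : hom a x = hom b x := by rw [h]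
  have hd : d = (hom p ⊔ hom q : QModHom Q X N) := by
    refine hX _ _ (QModHom.ext fun x => ?_) (QModHom.ext fun x => ?_)
    · have e₁ := app h₁ x
      have e₂ := app h₂ x
      have e₃ := app h₅ x
      rw [comp_apply] at e₁ e₂ e₃
      change hom d (hom i x) = (hom p ⊔ hom q) (hom i x)
      rw [sup_apply, e₁, e₂, e₃, hz0, sup_bot_eq]
    · have e₁ := app h₃ x
      have e₂ := app h₄ x
      have e₃ := app h₆ x
      rw [comp_apply] at e₁ e₂ e₃
      change hom d (hom j x) = (hom p ⊔ hom q) (hom j x)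
      rw [sup_apply, e₁, e₂, e₃, hz0, bot_sup_eq]
  refine QModHom.ext fun x => ?_
  have := app hd (hom k x)
  rw [sup_apply, comp_apply, this]
  exact sup_apply _ _ _

/-- The biproduct is `N ^ 2`, indexed by `Bool`, with the join of the two projections as codiagonal.
Its inclusions are jointly epimorphic because each pair is the join of its two included coordinates.
-/
theorem isBiproductSum_sup {M N : LMod Q} (f g : M ⟶ N) :
    IsBiproductSum f g (hom f ⊔ hom g : QModHom Q M N) := by
  let pr (b : Bool) : QModHom Q (Bool → N) N :=
    QModHom.ofFun (fun x => x b) (fun S => by simp [sSup_apply, iSup_subtype']) fun _ _ => rfl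
  let pair {A : LMod Q} (f g : QModHom Q A N) : QModHom Q A (Bool → N) :=
    QModHom.ofFun (fun x b => bif b then f x else g x)
      (fun S => by ext b; cases b <;> simp [QModHom.map_sSup])
      (fun a x => by ext b; cases b <;> simp [QModHom.map_smul])
  refine ⟨⟨Bool → N⟩, pair (QModHom.id Q N) ⊥, pair ⊥ (QModHom.id Q N), pr true, pr false,
    (pr true ⊔ pr false : QModHom Q (Bool → N) N), pair f g, (⊥ : QModHom Q N N),
    fun a b => ?_, fun a b ha hb => ?_, ?_, ?_, ?_, ?_, ?_, ?_, rfl, rfl, ?_⟩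
  · refine QModHom.ext fun x => ?_
    exact (bot_apply _).trans (bot_apply _).symm
  · refine QModHom.ext fun (x : Bool → N) => ?_
    have hx : x = pair (QModHom.id Q N) ⊥ (x true) ⊔ pair ⊥ (QModHom.id Q N) (x false) := by
      ext b
      cases b <;> simp [pair, bot_apply]
    have e₁ := DFunLike.congr_fun (F := QModHom Q N N) ha (x true)
    have e₂ := DFunLike.congr_fun (F := QModHom Q N N) hb (x false)
    rw [hx]
    refine (map_sup (M := ⟨Bool → N⟩) (hom a) _ _).trans ?_
    refine Eq.trans ?_ (map_sup (M := ⟨Bool → N⟩) (hom b) _ _).symm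
    exact congrArg₂ (· ⊔ ·) e₁ e₂
  · rfl
  · rfl
  · rfl
  · rfl
  · refine QModHom.ext fun x => ?_
    refine (sup_apply (M := ⟨Bool → N⟩) _ _ _).trans ?_
    exact (congrArg (x ⊔ ·) (bot_apply _)).trans (sup_bot_eq x)
  · refine QModHom.ext fun x => ?_
    refine (sup_apply (M := ⟨Bool → N⟩) _ _ _).trans ?_
    exact (congrArg (· ⊔ x) (bot_apply _)).trans (bot_sup_eq x)
  · refine QModHom.ext fun x => ?_
    refine (sup_apply (M := ⟨Bool → N⟩) _ _ _).trans ?_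
    exact (sup_apply (hom f) (hom g) x).symm

/-- A fully faithful functor is an order isomorphism on homomorphisms. -/
noncomputable def mapOrderIso (F : LMod Q ⥤ LMod R) [F.Full] [F.Faithful] (M N : LMod Q) :
    QModHom Q M N ≃o QModHom R (F.obj M) (F.obj N) where
  toEquiv := (Functor.FullyFaithful.ofFullyFaithful F).homEquiv (X := M) (Y := N)
  map_rel_iff' {f g} := by
    change hom (F.map f) ≤ hom (F.map g) ↔ f ≤ g
    -- The order is recovered from binary joins, `f ≤ g ↔ f ⊔ g = g`. Infinite joins need no
    -- separate argument, as an order isomorphism preserves them.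
    rw [← sup_eq_right, ← sup_eq_right, ← ((isBiproductSum_sup f g).map F).eq_sup]
    exact F.map_injective.eq_iff (a := (f ⊔ g : QModHom Q M N)) (b := g)

theorem mapOrderIso_apply (F : LMod Q ⥤ LMod R) [F.Full] [F.Faithful] {M N : LMod Q}
    (f : M ⟶ N) : mapOrderIso F M N f = F.map f := rfl

end LMod

/-! ### The progenerator of an equivalence -/

namespace LMod

section OfEquivalence

variable {Q R : Type u} [Monoid Q] [CompleteLattice Q] [IsQuantale Q]
  [Monoid R] [CompleteLattice R] [IsQuantale R]

/-- The free module `R` is projective, since a morphism out of it is lifted by lifting the image of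
1. Transposing along `E` moves the lifting problem to one for `R`, where the map to be lifted
through is still surjective. -/
theorem isProjective_inverse_obj_self (E : LMod Q ≌ LMod R) :
    (E.inverse.obj (self R)).IsProjective := by
  intro A B (g : A ⟶ B) (f : E.inverse.obj (self R) ⟶ B) hg
  let f' : self R ⟶ E.functor.obj B := E.counitInv.app _ ≫ E.functor.map f
  obtain ⟨y, hy⟩ := surjective_map E g hg (hom f' (1 : R))
  let h' : self R ⟶ E.functor.obj A := toSpan _ y
  have hh : h' ≫ E.functor.map g = f' := by
    refine QModHom.ext fun (a : R) => ?_
    change hom (E.functor.map g) (a • y) = hom f' a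
    rw [QModHom.map_smul, hy, ← QModHom.map_smul, smul_eq_mul, mul_one]
  refine ⟨(E.inverse.map h' ≫ E.unitInv.app A : E.inverse.obj (self R) ⟶ A), ?_⟩
  change (E.inverse.map h' ≫ E.unitInv.app A) ≫ g = f
  have h₁ : E.unitInv.app A ≫ g = E.inverse.map (E.functor.map g) ≫ E.unitInv.app B :=
    (E.unitInv.naturality g).symm
  have h₂ : E.inverse.map (E.functor.map f) ≫ E.unitInv.app B = E.unitInv.app _ ≫ f :=
    E.unitInv.naturality f
  rw [Category.assoc, h₁, ← E.inverse.map_comp_assoc, hh]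
  simp only [f', Functor.map_comp, Category.assoc, h₂]
  exact E.inverse_counitInv_comp_assoc _ _

/-- By the symmetric statement, the image `F` of `Q` is projective over `R`, so its identity is a
join of endomorphisms factoring through `R`. Carried back to left `Q`-modules, the identity of `Q`
becomes a join of endomorphisms factoring through the image of `R`. -/
theorem isGenerator_inverse_obj_self (E : LMod Q ≌ LMod R) :
    (E.inverse.obj (self R)).IsGenerator := by
  obtain ⟨f, hf⟩ := (isProjective_inverse_obj_self E.symm).exists_dualBasis
  let F := E.functor.obj (self Q)
  let φ (u : F) : F ⟶ self R := f u
  let σ (u : F) : self R ⟶ F := F.toSpan u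
  have h₁ : (⨆ u, (φ u ≫ σ u : F ⟶ F) : QModHom R F F) = 𝟙 F :=
    QModHom.ext fun x => (QModHom.iSup_apply _ x).trans (hf x)
  -- The join is infinite; it survives transport because `mapOrderIso` is an order isomorphism.
  have h₂ : (⨆ u, (E.inverse.map (φ u) ≫ E.inverse.map (σ u)) :
      QModHom Q (E.inverse.obj F) (E.inverse.obj F)) = 𝟙 (E.inverse.obj F) := by
    have := congrArg (mapOrderIso E.inverse F F) h₁
    rw [OrderIso.map_iSup] at this
    simp only [mapOrderIso_apply, Functor.map_comp] at this
    exact this.trans (E.inverse.map_id F)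
  let α : self Q ⟶ E.inverse.obj F := E.unit.app (self Q)
  let β : E.inverse.obj F ⟶ self Q := E.unitInv.app (self Q)
  refine isGenerator_of_iSup_eq_one (I := F) (fun u => hom (E.inverse.map (φ u)) (hom α (1 : Q)))
    (fun u => hom (E.inverse.map (σ u) ≫ β)) ?_
  -- Evaluate at the element corresponding to 1 under the unit `α`, then return to `Q` by its
  -- inverse `β`.
  have h₃ := DFunLike.congr_fun (F := QModHom Q _ _) h₂ (hom α (1 : Q))
  rw [QModHom.iSup_apply] at h₃
  have h₄ := congrArg (hom β) h₃
  rw [QModHom.map_iSup] at h₄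
  refine h₄.trans ?_
  change hom (α ≫ β) (1 : Q) = 1
  rw [show α ≫ β = 𝟙 _ from E.unitIso.hom_inv_id_app _]
  rfl

theorem isProgenerator_inverse_obj_self (E : LMod Q ≌ LMod R) :
    (E.inverse.obj (self R)).IsProgenerator :=
  ⟨isProjective_inverse_obj_self E, isGenerator_inverse_obj_self E⟩

variable (R) in
/-- A quantale is the endomorphism quantale of its free module of rank one. -/
def endSelf : R ≃*o QEnd R R where
  toFun r := (self R).toSpan r
  invFun f := f 1
  left_inv r := one_mul r
  right_inv f := DFunLike.ext _ _ fun x => by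
    change x • f 1 = f x
    rw [← QEnd.map_smul, smul_eq_mul, mul_one]
  -- An endomorphism of `R` is right multiplication by an element. These compose in the order of the
  -- product of `QEnd`, so no opposite appears.
  map_mul' r s := DFunLike.ext _ _ fun x => (mul_assoc x r s).symm
  map_le_map_iff' {r s} := by
    refine ⟨fun h => ?_, fun h x => mul_le_mul_right h x⟩
    have := h (1 : R)
    change (1 : R) * r ≤ 1 * s at this
    rwa [one_mul, one_mul] at this

/-- Fully faithful functors preserve endomorphism quantales. -/
noncomputable def endMap (F : LMod R ⥤ LMod Q) [F.Full] [F.Faithful] (M : LMod R) :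
    QEnd R M ≃*o QEnd Q (F.obj M) where
  toEquiv := (mapOrderIso F M M).toEquiv
  map_mul' f g := F.map_comp (X := M) (Y := M) (Z := M) f g
  map_le_map_iff' := (mapOrderIso F M M).map_rel_iff

theorem exists_isProgenerator_of_equivalence (E : LMod Q ≌ LMod R) :
    ∃ P : LMod Q, P.IsProgenerator ∧ Nonempty (R ≃*o QEnd Q P) :=
  ⟨E.inverse.obj (self R), isProgenerator_inverse_obj_self E,
    ⟨(endSelf R).trans (endMap E.inverse (self R))⟩⟩

end OfEquivalence

/-! ### Restriction along an isomorphism -/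

section Restrict

variable {Q R : Type u} [Monoid Q] [CompleteLattice Q] [Monoid R] [CompleteLattice R]

/-- Restriction of the action along an isomorphism of quantales. -/
def restrict (e : Q ≃*o R) : LMod R ⥤ LMod Q where
  obj M :=
    letI act : MulAction Q M :=
      { smul := fun a x => e a • x
        one_smul := fun x => by
          change e 1 • x = x
          rw [map_one, one_smul]
        mul_smul := fun a b x => by
          change e (a * b) • x = e a • e b • x
          rw [map_mul, mul_smul] }
    { carrier := M
      isModule :=
        { smul_sSup := fun a S => IsQuantaleModule.smul_sSup (e a) S
          sSup_smul := fun A x => by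
            change e (sSup A) • x = ⨆ a ∈ A, e a • x
            simp only [sSup_eq_iSup, _root_.map_iSup, IsQuantaleModule.iSup_smul] } }
  map {M N} f := QModHom.ofFun (hom f) (fun S => QModHom.map_sSup (hom f) S)
    (fun a u => QModHom.map_smul (hom f) (e a) u)

/-- Isomorphic quantales have equivalent module categories. -/
def restrictEquivalence (e : Q ≃*o R) : LMod R ≌ LMod Q :=
  CategoryTheory.Equivalence.mk (restrict e) (restrict e.symm)
    (NatIso.ofComponents fun M =>
      { hom := QModHom.ofFun (M := M)
          (N := ((restrict e ⋙ restrict e.symm).obj M).carrier) (fun x => x)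
          (fun _ => sSup_eq_iSup) (fun r x => by
            change r • x = e (e.symm r) • x
            rw [OrderMonoidIso.apply_symm_apply])
        inv := QModHom.ofFun (N := M)
          (M := ((restrict e ⋙ restrict e.symm).obj M).carrier) (fun x => x)
          (fun _ => sSup_eq_iSup) (fun r (x : M) => by
            change e (e.symm r) • x = r • x
            rw [OrderMonoidIso.apply_symm_apply]) })
    (NatIso.ofComponents fun M =>
      { hom := QModHom.ofFun (N := M)
          (M := ((restrict e.symm ⋙ restrict e).obj M).carrier) (fun x => x)
          (fun _ => sSup_eq_iSup) (fun r (x : M) => by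
            change e.symm (e r) • x = r • x
            rw [OrderMonoidIso.symm_apply_apply])
        inv := QModHom.ofFun (M := M)
          (N := ((restrict e.symm ⋙ restrict e).obj M).carrier) (fun x => x)
          (fun _ => sSup_eq_iSup) (fun r x => by
            change r • x = e.symm (e r) • x
            rw [OrderMonoidIso.symm_apply_apply]) })

variable (Q) in
/-- The double opposite of a quantale. -/
def opOp : Q ≃*o Qᵐᵒᵖᵐᵒᵖ where
  toFun a := op (op a)
  invFun a := unop (unop a)
  map_mul' _ _ := rfl
  map_le_map_iff' := Iff.rfl

end Restrict

/-! ### Passing between left and right modules -/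

section Transfer

variable {Q R : Type u} [Monoid Q] [CompleteLattice Q] [IsQuantale Q]
  [Monoid R] [CompleteLattice R] [IsQuantale R]

theorem nonempty_rMod_equivalence
    (h : ∃ P : LMod Q, P.IsProgenerator ∧ Nonempty (R ≃*o QEnd Q P)) :
    Nonempty (RMod Q ≌ RMod R) := by
  obtain ⟨P, hP, ⟨e⟩⟩ := h
  exact ⟨(hP.exists_equivalence e).choose⟩

/-- Right modules are by definition left modules over the opposite, so `E` supplies a progenerator
over `Qᵐᵒᵖ`. Tensoring with it gives an equivalence of right modules over the opposites, that is, of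
left modules over the double opposites, which are isomorphic to `Q` and `R`. -/
theorem moritaEquivalent_of_rMod_equivalence (E : RMod Q ≌ RMod R) : MoritaEquivalent Q R := by
  obtain ⟨E'⟩ := nonempty_rMod_equivalence (exists_isProgenerator_of_equivalence E)
  exact ⟨(restrictEquivalence (opOp Q)).symm.trans (E'.trans (restrictEquivalence (opOp R)))⟩

end Transfer

end LMod

theorem theorem5 {Q R : Type u} [Monoid Q] [CompleteLattice Q] [IsQuantale Q]
    [Monoid R] [CompleteLattice R] [IsQuantale R] :
    (MoritaEquivalent Q R ↔
      ∃ P : LMod Q, P.IsProgenerator ∧ Nonempty (R ≃*o QEnd Q P)) ∧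
    (Nonempty (RMod Q ≌ RMod R) ↔
      ∃ P : LMod Q, P.IsProgenerator ∧ Nonempty (R ≃*o QEnd Q P)) ∧
    ∀ (P : LMod Q), P.IsProgenerator → ∀ e : R ≃*o QEnd Q P,
      ∃ E : RMod Q ≌ RMod R,
        E.functor = tensorFunctor (P.toBimod e) ∧ E.inverse = tensorFunctor (P.dualBimod e) := by
  have h₁ : MoritaEquivalent Q R → ∃ P : LMod Q, P.IsProgenerator ∧ Nonempty (R ≃*o QEnd Q P) :=
    fun ⟨E⟩ => LMod.exists_isProgenerator_of_equivalence E
  have h₂ : Nonempty (RMod Q ≌ RMod R) → MoritaEquivalent Q R :=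
    fun ⟨E⟩ => LMod.moritaEquivalent_of_rMod_equivalence E
  exact ⟨⟨h₁, fun h => h₂ (LMod.nonempty_rMod_equivalence h)⟩,
    ⟨fun h => h₁ (h₂ h), LMod.nonempty_rMod_equivalence⟩,
    fun _ hP e => hP.exists_equivalence e⟩
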